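/- Let $6\le m\le n$ and let $T_{m,n}$ be the torus with vertices $v_{i,j}$ ($0\le i<m$, $0\le j<n$), the Cartesian product of the cycle on the $m$ rows and the cycle on the $n$ columns. The cops choose their initial vertices, then the robber chooses its initial vertex knowing those of the cops; in each round first every cop and then the robber moves to an adjacent vertex or stays still, with full information, and the robber is captured as soon as some cop and the robber are on the same vertex. The capture time of a strategy of the cops is the least $t$ such that every robber is captured within $t$ rounds. A strategy of three cops is called guard-plus-chase if in every play one of the cops, the guard, is in the column of the robber after the cops' turn of each round $i\ge\lceil 2n/3\rceil-\lceil n/2\rceil$, $i \geq 1$, until the robber is captured, while the two other cops chase the robber. Then three cops have a guard-plus-chase strategy on $T_{m,n}$ whose capture time $t$ satisfies (i) $\frac{2n}{3}+\frac{5m}{4}-\frac92\le t\le\frac{2n}{3}+\frac{5m}{4}-\frac{25}{12}$ if $m\le\lceil n/2\rceil$; (ii) $\frac{25n}{24}+\frac m2-\frac92\le t\le\frac{25n}{24}+\frac m2-\frac{17}{8}$ if $\lceil n/2\rceil<m\le n$. -/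

import Mathlib

/-- The torus `T_{m,n}`: vertices `v_{i,j}` with row `i : Fin m` and column `j : Fin n`;
rows and columns are closed up cyclically (for `3 ≤ m, n`). -/
abbrev torus (m n : ℕ) : SimpleGraph (Fin m × Fin n) :=
  (SimpleGraph.cycleGraph m).boxProd (SimpleGraph.cycleGraph n)

/-- In its turn an agent stays still or moves to an adjacent vertex. -/
def CanMove {V : Type*} (G : SimpleGraph V) (u v : V) : Prop :=
  u = v ∨ G.Adj u v

/-- A play of the robber: `r 0` is its initial position, `r i` its position after its turn in
round `i`. -/
def IsRobberPlay {V : Type*} (G : SimpleGraph V) (r : ℕ → V) : Prop :=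
  ∀ i, CanMove G (r i) (r (i + 1))

/-- A (history dependent) strategy of `k` cops on `G`. If the robber plays `r`, then
`pos r 0 a` is the initial position of cop `a`, and `pos r i a` is its position after the cops'
turn of round `i`. The cops move first in each round, so `pos r i` may depend only on
`r 0, …, r (i - 1)`; in particular the initial positions do not depend on `r`. -/
structure CopStrategy {V : Type*} (G : SimpleGraph V) (k : ℕ) where
  pos : (ℕ → V) → ℕ → Fin k → V
  causal : ∀ (r r' : ℕ → V) (i : ℕ), (∀ j < i, r j = r' j) → pos r i = pos r' i
  legal : ∀ (r : ℕ → V) (i : ℕ) (a : Fin k), CanMove G (pos r i a) (pos r (i + 1) a)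

namespace CopStrategy

/-- In round `i` some cop and the robber are on the same vertex, either after the cops' turn (the
robber still being where it was at the end of round `i - 1`) or after the robber's turn.
Round `0` is the initial placement. -/
def CaughtIn {V : Type*} {G : SimpleGraph V} {k : ℕ} (σ : CopStrategy G k) (r : ℕ → V)
    (i : ℕ) : Prop :=
  ∃ a : Fin k, (∃ j, i = j + 1 ∧ σ.pos r i a = r j) ∨ σ.pos r i a = r i

/-- The robber is captured in at most `t` rounds. -/
def CapturedWithin {V : Type*} {G : SimpleGraph V} {k : ℕ} (σ : CopStrategy G k) (r : ℕ → V)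
    (t : ℕ) : Prop :=
  ∃ i ≤ t, σ.CaughtIn r i

/-- The capture time of the strategy `σ` is exactly `t`: every robber is captured within `t`
rounds, and no smaller number of rounds suffices against all robbers. -/
def HasCaptureTime {V : Type*} {G : SimpleGraph V} {k : ℕ} (σ : CopStrategy G k)
    (t : ℕ) : Prop :=
  IsLeast {s : ℕ | ∀ r : ℕ → V, IsRobberPlay G r → σ.CapturedWithin r s} t

/-- A guard-plus-chase strategy of three cops on `T_{m,n}`. In every play there is a cop `g`, the
guard, that has reached the column of the robber when the guard phase is over, which takes at most
`⌈2n/3⌉ - ⌈n/2⌉` rounds, and from then on follows the robber: after each cops' turn it is in the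
column of the robber, until the robber is captured. The two other cops chase the robber. -/
def IsGuardPlusChase {m n : ℕ} (σ : CopStrategy (torus m n) 3) : Prop :=
  ∀ r : ℕ → Fin m × Fin n, IsRobberPlay (torus m n) r →
    ∃ g : Fin 3, ∀ i : ℕ, (2 * n) ⌈/⌉ 3 - n ⌈/⌉ 2 ≤ i + 1 →
      ¬ σ.CapturedWithin r (i + 1) → (σ.pos r (i + 1) g).2 = (r i).2

end CopStrategy

/-! The cops start evenly spaced in one row. The two that enclose the column of the robber close in
on it from both sides, so after about `n / 6` rounds one of them, the guard, is in that column. All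
cops are then still in their row, and the two others are at least `n / 3` columns apart either way
around. From then on the guard copies the sideways moves of the robber.

Relative to the robber, the chase is a potential argument. A chaser on a diagonal through the robber
covers two of the four directions: a step of the robber towards it lets it return to the diagonal,
closer. The other chaser and the guard cover the remaining two, and a weighted distance drops by two
in each round (`Win.of_diagonal`). A diagonal is reached by a vertical approach
(`Win.of_column_near`) or a horizontal one (`Win.of_row_near`); `guardedWin_of_same_row` combines
the two.

The claim is about the capture time of some strategy, not of the best one, so its lower bound is met
by delay. Fix an integer `t` in the required interval. While the remaining rounds suffice for a win
from the present relative position, the cops merely translate along with the robber. Then some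
robber survives `t - 1` rounds (`Feasible.exists_survivor`) and none survives `t`. What is left is
arithmetic: `t` is large enough in the sense of `Feasible`. -/

/-! ### The chase in integer coordinates relative to the robber -/

/-- A displacement by at most one step along one of the two axes. -/
def UnitStep (a b : ℤ) : Prop :=
  (a = 0 ∧ b = 0) ∨ (a = 1 ∧ b = 0) ∨ (a = -1 ∧ b = 0) ∨ (a = 0 ∧ b = 1) ∨ (a = 0 ∧ b = -1)

theorem UnitStep.neg_left {a b : ℤ} (h : UnitStep a b) : UnitStep (-a) b := by
  unfold UnitStep at *; omega

theorem UnitStep.neg_right {a b : ℤ} (h : UnitStep a b) : UnitStep a (-b) := by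
  unfold UnitStep at *; omega

/-- The chase in coordinates relative to the robber, which is about to move: the guard is at
`(g, 0)`, the chasers are at `(xA, yA)` and `(xB, yB)`, and `Win m n t` says that the cops, the
guard keeping to the column of the robber, win within `t` further rounds on the torus `T_{m,n}`. -/
def Win (m n : ℕ) : ℕ → ℤ → ℤ → ℤ → ℤ → ℤ → Prop
  | 0, g, xA, yA, xB, yB =>
      (m : ℤ) ∣ g ∨ ((m : ℤ) ∣ xA ∧ (n : ℤ) ∣ yA) ∨ ((m : ℤ) ∣ xB ∧ (n : ℤ) ∣ yB)
  | t + 1, g, xA, yA, xB, yB =>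
      ((m : ℤ) ∣ g ∨ ((m : ℤ) ∣ xA ∧ (n : ℤ) ∣ yA) ∨ ((m : ℤ) ∣ xB ∧ (n : ℤ) ∣ yB)) ∨
      ∀ dx dy, UnitStep dx dy → ∃ g' xA' yA' xB' yB',
        -- The true displacement of a cop is its relative displacement plus that of the robber; the
        -- guard has to match `dy`.
        UnitStep (g' - g + dx) dy ∧ UnitStep (xA' - xA + dx) (yA' - yA + dy) ∧
        UnitStep (xB' - xB + dx) (yB' - yB + dy) ∧ Win m n t g' xA' yA' xB' yB'

namespace Win

variable {m n t : ℕ} {g xA yA xB yB : ℤ}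

theorem of_caught
    (h : (m : ℤ) ∣ g ∨ ((m : ℤ) ∣ xA ∧ (n : ℤ) ∣ yA) ∨ ((m : ℤ) ∣ xB ∧ (n : ℤ) ∣ yB)) :
    Win m n t g xA yA xB yB := by
  cases t with
  | zero => exact h
  | succ t => exact Or.inl h

theorem of_guard_zero : Win m n t 0 xA yA xB yB := of_caught (Or.inl (dvd_zero _))

theorem of_chaser_zero : Win m n t g 0 0 xB yB :=
  of_caught (Or.inr (Or.inl ⟨dvd_zero _, dvd_zero _⟩))

theorem of_chaser_zero' : Win m n t g xA yA 0 0 :=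
  of_caught (Or.inr (Or.inr ⟨dvd_zero _, dvd_zero _⟩))

/-- Positions matter only modulo the periods of the torus. -/
theorem add_periods (h : Win m n t g xA yA xB yB) {g' xA' yA' xB' yB' : ℤ}
    (hg : (m : ℤ) ∣ g' - g) (h1 : (m : ℤ) ∣ xA' - xA) (h2 : (n : ℤ) ∣ yA' - yA)
    (h3 : (m : ℤ) ∣ xB' - xB) (h4 : (n : ℤ) ∣ yB' - yB) : Win m n t g' xA' yA' xB' yB' := by
  have caught : ((m : ℤ) ∣ g ∨ ((m : ℤ) ∣ xA ∧ (n : ℤ) ∣ yA) ∨ ((m : ℤ) ∣ xB ∧ (n : ℤ) ∣ yB)) →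
      ((m : ℤ) ∣ g' ∨ ((m : ℤ) ∣ xA' ∧ (n : ℤ) ∣ yA') ∨ ((m : ℤ) ∣ xB' ∧ (n : ℤ) ∣ yB')) := by
    rw [dvd_iff_dvd_of_dvd_sub hg, dvd_iff_dvd_of_dvd_sub h1, dvd_iff_dvd_of_dvd_sub h2,
      dvd_iff_dvd_of_dvd_sub h3, dvd_iff_dvd_of_dvd_sub h4]
    exact id
  induction t generalizing g xA yA xB yB g' xA' yA' xB' yB' with
  | zero => exact caught h
  | succ t ih =>
    rcases h with h | h
    · exact Or.inl (caught h)
    refine Or.inr fun dx dy hd => ?_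
    obtain ⟨a, b, c, d, e, k1, k2, k3, k4⟩ := h dx dy hd
    refine ⟨a + (g' - g), b + (xA' - xA), c + (yA' - yA), d + (xB' - xB), e + (yB' - yB),
      ?_, ?_, ?_, ih k4 (by simpa using hg) (by simpa using h1) (by simpa using h2)
        (by simpa using h3) (by simpa using h4) ?_⟩
    · convert k1 using 1; ring
    · convert k2 using 1 <;> ring
    · convert k3 using 1 <;> ring
    · rw [dvd_iff_dvd_of_dvd_sub (a := (m : ℤ)) (b := a + (g' - g)) (c := a) (by simpa using hg),
        dvd_iff_dvd_of_dvd_sub (a := (m : ℤ)) (b := b + (xA' - xA)) (c := b) (by simpa using h1),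
        dvd_iff_dvd_of_dvd_sub (a := (n : ℤ)) (b := c + (yA' - yA)) (c := c) (by simpa using h2),
        dvd_iff_dvd_of_dvd_sub (a := (m : ℤ)) (b := d + (xB' - xB)) (c := d) (by simpa using h3),
        dvd_iff_dvd_of_dvd_sub (a := (n : ℤ)) (b := e + (yB' - yB)) (c := e) (by simpa using h4)]
      exact id

theorem reflect_col (h : Win m n t g xA yA xB yB) : Win m n t g xA (-yA) xB (-yB) := by
  induction t generalizing g xA yA xB yB with
  | zero => simpa [Win] using h
  | succ t ih =>
    rcases h with h | h
    · exact Or.inl (by simpa using h)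
    refine Or.inr fun dx dy hd => ?_
    obtain ⟨a, b, c, d, e, k1, k2, k3, k4⟩ := h dx (-dy) hd.neg_right
    refine ⟨a, b, -c, d, -e, ?_, ?_, ?_, ih k4⟩
    · simpa using k1.neg_right
    · convert k2.neg_right using 1; ring
    · convert k3.neg_right using 1; ring

theorem reflect_row (h : Win m n t g xA yA xB yB) : Win m n t (-g) (-xA) yA (-xB) yB := by
  induction t generalizing g xA yA xB yB with
  | zero => simpa [Win] using h
  | succ t ih =>
    rcases h with h | h
    · exact Or.inl (by simpa using h)
    refine Or.inr fun dx dy hd => ?_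
    obtain ⟨a, b, c, d, e, k1, k2, k3, k4⟩ := h (-dx) dy hd.neg_left
    refine ⟨-a, -b, c, -d, e, ?_, ?_, ?_, ih k4⟩
    · convert k1.neg_left using 1; ring
    · convert k2.neg_left using 1; ring
    · convert k3.neg_left using 1; ring

theorem swap (h : Win m n t g xA yA xB yB) : Win m n t g xB yB xA yA := by
  induction t generalizing g xA yA xB yB with
  | zero => unfold Win at *; tauto
  | succ t ih =>
    rcases h with h | h
    · exact Or.inl (by tauto)
    refine Or.inr fun dx dy hd => ?_
    obtain ⟨a, b, c, d, e, k1, k2, k3, k4⟩ := h dx dy hd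
    exact ⟨a, d, e, b, c, k1, k3, k2, ih k4⟩

/-- To win in `t + 1` rounds, answer each of the five moves of the robber. -/
theorem of_moves
    (h : ∀ dx dy, UnitStep dx dy → ∃ g' xA' yA' xB' yB',
      UnitStep (g' - g + dx) dy ∧ UnitStep (xA' - xA + dx) (yA' - yA + dy) ∧
      UnitStep (xB' - xB + dx) (yB' - yB + dy) ∧ Win m n t g' xA' yA' xB' yB') :
    Win m n (t + 1) g xA yA xB yB := Or.inr h

/-- One chaser is on a diagonal and so stops two directions of the robber, the other chaser stops
the third, and the guard the fourth. -/
theorem of_diagonal {k g x b : ℤ} (hk : 0 ≤ k) (hg : 0 ≤ g) (hx : 0 ≤ x) (hxb : x ≤ b)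
    (h : 2 * k + g + x + b ≤ 2 * t + 3) : Win m n t (-g) k k x (-b) := by
  -- The potential `2 * k + g + x + b` drops by at least 2 in each round without capture: by `k` if
  -- the robber moves towards the diagonal chaser, by `g` alone if it moves towards the guard, by
  -- `x` and `b` if towards the other chaser, and by `g` and one of `x`, `b` if it stays. As `x ≤ b`
  -- is preserved, an uncaught robber has `0 < b`, so the other chaser keeps covering its direction.
  induction t generalizing k g x b with
  | zero =>
    obtain rfl | hk := hk.eq_or_lt
    · exact of_chaser_zero
    obtain rfl | hg := hg.eq_or_lt
    · simpa using of_guard_zero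
    obtain rfl : b = 0 := by push_cast at h; omega
    obtain rfl : x = 0 := by omega
    simpa using of_chaser_zero'
  | succ t ih =>
    push_cast at h
    obtain rfl | hk := hk.eq_or_lt
    · exact of_chaser_zero
    obtain rfl | hg := hg.eq_or_lt
    · simpa using of_guard_zero
    by_cases hb : b = 0
    · obtain rfl : x = 0 := by omega
      subst hb
      simpa using of_chaser_zero'
    refine of_moves fun dx dy hd => ?_
    rcases hd with ⟨rfl, rfl⟩ | ⟨rfl, rfl⟩ | ⟨rfl, rfl⟩ | ⟨rfl, rfl⟩ | ⟨rfl, rfl⟩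
    · by_cases hx0 : x = 0
      · refine ⟨-(g - 1), k, k, x, -(b - 1), ?_, ?_, ?_,
          ih (by omega) (by omega) (by omega) (by omega) (by omega)⟩ <;> unfold UnitStep <;> omega
      · refine ⟨-(g - 1), k, k, x - 1, -b, ?_, ?_, ?_,
          ih (by omega) (by omega) (by omega) (by omega) (by omega)⟩ <;> unfold UnitStep <;> omega
    · refine ⟨-g, k - 1, k - 1, x, -b, ?_, ?_, ?_,
        ih (by omega) (by omega) (by omega) (by omega) (by omega)⟩ <;> unfold UnitStep <;> omega
    · by_cases hg1 : g = 1
      · refine ⟨0, k, k, x, -b, ?_, ?_, ?_, of_guard_zero⟩ <;> unfold UnitStep <;> omega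
      · refine ⟨-(g - 2), k, k, x, -b, ?_, ?_, ?_,
          ih (by omega) (by omega) (by omega) (by omega) (by omega)⟩ <;> unfold UnitStep <;> omega
    · refine ⟨-g, k - 1, k - 1, x, -b, ?_, ?_, ?_,
        ih (by omega) (by omega) (by omega) (by omega) (by omega)⟩ <;> unfold UnitStep <;> omega
    · by_cases hx0 : x = 0
      · by_cases hb1 : b = 1
        · refine ⟨-g, k, k, 0, 0, ?_, ?_, ?_, of_chaser_zero'⟩ <;> unfold UnitStep <;> omega
        · refine ⟨-g, k, k, x, -(b - 2), ?_, ?_, ?_,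
            ih (by omega) (by omega) (by omega) (by omega) (by omega)⟩ <;>
            unfold UnitStep <;> omega
      · refine ⟨-g, k, k, x - 1, -(b - 1), ?_, ?_, ?_,
          ih (by omega) (by omega) (by omega) (by omega) (by omega)⟩ <;> unfold UnitStep <;> omega

/-- `of_diagonal` with the roles of the two chasers exchanged. -/
theorem of_diagonal' {k g x b : ℤ} (hk : 0 ≤ k) (hg : 0 ≤ g) (hx : 0 ≤ x) (hxb : x ≤ b)
    (h : 2 * k + g + x + b ≤ 2 * t + 3) : Win m n t (-g) x b k (-k) := by
  simpa using (of_diagonal (m := m) (n := n) hk hg hx hxb h).swap.reflect_col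

/-- The chasers are in one row, and one of them is nearer to the column of the robber than to its
row: they approach vertically until one of them is on a diagonal. -/
theorem of_column_near {x g e f : ℤ} (hg : 0 ≤ g) (he : 0 ≤ e) (hf : 0 ≤ f)
    (hs : 0 < e + f) (hsn : e + f < n) (hx : e ≤ x ∨ f ≤ x)
    (h1 : 2 * x + g + (e + f) ≤ 2 * t + 2) (h2 : 2 * x + g + (n - (e + f)) ≤ 2 * t + 2) :
    Win m n t (-g) x e x (-f) := by
  -- Both potentials drop by 2 in each round, through `x` or, if the robber flees vertically,
  -- through `g`. Two are needed because a robber that crosses the column of a chaser exchanges `e +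
  -- f` with `n - (e + f)`.
  induction t generalizing x g e f with
  | zero =>
    obtain rfl | hg := hg.eq_or_lt
    · simpa using of_guard_zero
    push_cast at h1 h2
    obtain rfl : x = 0 := by omega
    rcases hx with hx | hx
    · obtain rfl : e = 0 := by omega
      exact of_chaser_zero
    · obtain rfl : f = 0 := by omega
      simpa using of_chaser_zero'
  | succ t ih =>
    push_cast at h1 h2
    obtain rfl | hg := hg.eq_or_lt
    · simpa using of_guard_zero
    by_cases hxe : x = e ∧ e ≤ f
    · obtain ⟨rfl, hef⟩ := hxe
      exact of_diagonal he hg.le he hef (by push_cast; omega)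
    by_cases hxf : x = f ∧ f ≤ e
    · obtain ⟨rfl, hef⟩ := hxf
      exact of_diagonal' hf hg.le hf hef (by push_cast; omega)
    have hlt : e < x ∨ f < x := by omega
    refine of_moves fun dx dy hd => ?_
    rcases hd with ⟨rfl, rfl⟩ | ⟨rfl, rfl⟩ | ⟨rfl, rfl⟩ | ⟨rfl, rfl⟩ | ⟨rfl, rfl⟩
    · refine ⟨-g, x - 1, e, x - 1, -f, ?_, ?_, ?_, ih hg.le he hf hs hsn (by omega)
        (by omega) (by omega)⟩ <;> unfold UnitStep <;> omega
    · refine ⟨-g, x - 1, e, x - 1, -f, ?_, ?_, ?_, ih hg.le he hf hs hsn (by omega)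
        (by omega) (by omega)⟩ <;> unfold UnitStep <;> omega
    · by_cases hg1 : g = 1
      · refine ⟨0, x, e, x, -f, ?_, ?_, ?_, of_guard_zero⟩ <;> unfold UnitStep <;> omega
      · refine ⟨-(g - 2), x, e, x, -f, ?_, ?_, ?_, ih (by omega) he hf hs hsn (by omega)
          (by omega) (by omega)⟩ <;> unfold UnitStep <;> omega
    -- For `e = 0` the sidestep crosses the column of the first chaser: the chasers exchange sides,
    -- up to a period `n`.
    · obtain rfl | he := he.eq_or_lt
      · by_cases hx1 : x = 1
        · subst hx1
          by_cases hfn : f + 1 = n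
          · refine ⟨-g, 0, -1, 0, -(f + 1), ?_, ?_, ?_, of_caught (Or.inr (Or.inr ⟨by simp, ?_⟩))⟩
            · unfold UnitStep; omega
            · unfold UnitStep; omega
            · unfold UnitStep; omega
            · rw [hfn]; simp
          · refine ⟨-g, 1, -1, 0, -(f + 1), ?_, ?_, ?_, ?_⟩
            · unfold UnitStep; omega
            · unfold UnitStep; omega
            · unfold UnitStep; omega
            · have := (of_diagonal' (m := m) (n := n) (t := t) (k := 1) (g := g) (x := 0)
                (b := n - f - 1) (by omega) (by omega) (by omega) (by omega) (by omega)).swap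
              exact this.add_periods (by simp) (by simp) (by simp) (by simp) ⟨-1, by ring⟩
        · have := (ih (x := x - 1) (g := g) (e := n - f - 1) (f := 1) hg.le (by omega) (by omega)
            (by omega) (by omega) (by omega) (by omega) (by omega)).swap
          refine ⟨-g, x - 1, -1, x - 1, -(f + 1), ?_, ?_, ?_,
            this.add_periods (by simp) (by simp) (by simp) (by simp) ⟨-1, by ring⟩⟩ <;>
            unfold UnitStep <;> omega
      · by_cases hmin : e - 1 ≤ x - 1 ∨ f + 1 ≤ x - 1
        · refine ⟨-g, x - 1, e - 1, x - 1, -(f + 1), ?_, ?_, ?_, ih hg.le (by omega) (by omega)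
            (by omega) (by omega) (by omega) (by omega) (by omega)⟩ <;> unfold UnitStep <;> omega
        -- Here `f + 1 = x`: the second chaser stands still, and the sidestep of the robber puts it
        -- on its diagonal.
        · refine ⟨-g, x - 1, e - 1, x, -x, ?_, ?_, ?_, of_diagonal' (by omega) hg.le (by omega)
            (by omega) (by omega)⟩ <;> unfold UnitStep <;> omega
    · obtain rfl | hf := hf.eq_or_lt
      · by_cases hx1 : x = 1
        · subst hx1
          by_cases hen : e + 1 = n
          · refine ⟨-g, 0, e + 1, 0, 1, ?_, ?_, ?_, of_caught (Or.inr (Or.inl ⟨by simp, ?_⟩))⟩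
            · unfold UnitStep; omega
            · unfold UnitStep; omega
            · unfold UnitStep; omega
            · rw [hen]
          · refine ⟨-g, 0, e + 1, 1, 1, ?_, ?_, ?_, ?_⟩
            · unfold UnitStep; omega
            · unfold UnitStep; omega
            · unfold UnitStep; omega
            · have := (of_diagonal (m := m) (n := n) (t := t) (k := 1) (g := g) (x := 0)
                (b := n - e - 1) (by omega) (by omega) (by omega) (by omega) (by omega)).swap
              exact this.add_periods (by simp) (by simp) ⟨1, by ring⟩ (by simp) (by simp)
        · have := (ih (x := x - 1) (g := g) (e := 1) (f := n - e - 1) hg.le (by omega) (by omega)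
            (by omega) (by omega) (by omega) (by omega) (by omega)).swap
          refine ⟨-g, x - 1, e + 1, x - 1, 1, ?_, ?_, ?_,
            this.add_periods (by simp) (by simp) ⟨1, by ring⟩ (by simp) (by simp)⟩ <;>
            unfold UnitStep <;> omega
      · by_cases hmin : e + 1 ≤ x - 1 ∨ f - 1 ≤ x - 1
        · refine ⟨-g, x - 1, e + 1, x - 1, -(f - 1), ?_, ?_, ?_, ih hg.le (by omega) (by omega)
            (by omega) (by omega) (by omega) (by omega) (by omega)⟩ <;> unfold UnitStep <;> omega
        · refine ⟨-g, x, x, x - 1, -(f - 1), ?_, ?_, ?_, of_diagonal (by omega) hg.le (by omega)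
            (by omega) (by omega)⟩ <;> unfold UnitStep <;> omega

/-- The chasers are in the row of the guard, on either side of the robber, and both of them are
nearer to its row than to its column: they approach horizontally until one of them is on a
diagonal. -/
theorem of_row_near {x g e f : ℤ} (hm : 2 ≤ m) (hx : 0 ≤ x) (hg : 0 ≤ g) (hxg : x + g = m)
    (he : x ≤ e) (hf : x ≤ f)
    (h : e + f + 2 * m ≤ 2 * t + 3 ∨ 5 * (e + f) + 2 * x + 4 * m ≤ 8 * t + 10) :
    Win m n t (-g) x e x (-f) := by
  -- In each round short of a diagonal `e + f` drops by 2 and `x` grows by at most 1, so the left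
  -- sides drop by at least 2 and by at least `10 - 2 = 8`. On a diagonal the potential of
  -- `of_diagonal` is `e + f + x + m`. It is at most `e + f + 2 * m`, and four times it is at most
  -- `5 * (e + f) + 2 * x + 4 * m`, because `2 * x ≤ e + f`.
  induction t generalizing x g e f with
  | zero =>
    push_cast at h
    obtain rfl | hg := hg.eq_or_lt
    · simpa using of_guard_zero
    obtain rfl | hx := hx.eq_or_lt
    · refine of_caught (Or.inl ?_)
      obtain rfl : g = m := by omega
      simp
    omega
  | succ t ih =>
    push_cast at h
    obtain rfl | hg := hg.eq_or_lt
    · simpa using of_guard_zero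
    obtain rfl | hx := hx.eq_or_lt
    · refine of_caught (Or.inl ?_)
      obtain rfl : g = m := by omega
      simp
    by_cases hxe : x = e
    · subst hxe
      exact of_diagonal hx.le hg.le hx.le hf (by push_cast; omega)
    by_cases hxf : x = f
    · subst hxf
      exact of_diagonal' hx.le hg.le hx.le he (by push_cast; omega)
    refine of_moves fun dx dy hd => ?_
    -- A chaser one column short of its diagonal stands still when the robber's move completes the
    -- diagonal.
    rcases hd with ⟨rfl, rfl⟩ | ⟨rfl, rfl⟩ | ⟨rfl, rfl⟩ | ⟨rfl, rfl⟩ | ⟨rfl, rfl⟩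
    · refine ⟨-g, x, e - 1, x, -(f - 1), ?_, ?_, ?_, ih hx.le hg.le hxg (by omega) (by omega)
        (by omega)⟩ <;> unfold UnitStep <;> omega
    · refine ⟨-(g + 1), x - 1, e - 1, x - 1, -(f - 1), ?_, ?_, ?_, ih (by omega) (by omega)
        (by omega) (by omega) (by omega) (by omega)⟩ <;> unfold UnitStep <;> omega
    · by_cases hg1 : g = 1
      · refine ⟨0, x, e, x, -f, ?_, ?_, ?_, of_guard_zero⟩ <;> unfold UnitStep <;> omega
      by_cases he1 : x + 1 = e
      · subst he1
        refine ⟨-(g - 2), x + 1, x + 1, x, -f, ?_, ?_, ?_, of_diagonal (by omega) (by omega)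
          (by omega) (by omega) (by omega)⟩ <;> unfold UnitStep <;> omega
      by_cases hf1 : x + 1 = f
      · subst hf1
        refine ⟨-(g - 2), x, e, x + 1, -(x + 1), ?_, ?_, ?_, of_diagonal' (by omega) (by omega)
          (by omega) (by omega) (by omega)⟩ <;> unfold UnitStep <;> omega
      refine ⟨-(g - 1), x + 1, e - 1, x + 1, -(f - 1), ?_, ?_, ?_, ih (by omega) (by omega)
        (by omega) (by omega) (by omega) (by omega)⟩ <;> unfold UnitStep <;> omega
    · by_cases he1 : x + 1 = e
      · subst he1
        refine ⟨-g, x, x, x, -f, ?_, ?_, ?_, of_diagonal hx.le hg.le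
          (by omega) (by omega) (by omega)⟩ <;> unfold UnitStep <;> omega
      refine ⟨-g, x, e - 2, x, -f, ?_, ?_, ?_, ih hx.le hg.le hxg (by omega) (by omega)
        (by omega)⟩ <;> unfold UnitStep <;> omega
    · by_cases hf1 : x + 1 = f
      · subst hf1
        refine ⟨-g, x, e, x, -x, ?_, ?_, ?_, of_diagonal' hx.le hg.le
          (by omega) (by omega) (by omega)⟩ <;> unfold UnitStep <;> omega
      refine ⟨-g, x, e, x, -(f - 2), ?_, ?_, ?_, ih hx.le hg.le hxg (by omega) (by omega)
        (by omega)⟩ <;> unfold UnitStep <;> omega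

end Win

/-! ### Transfer from integer coordinates to the torus -/

section Torus

open Fin.CommRing

theorem Fin.intCast_eq_intCast_iff_dvd {n : ℕ} [NeZero n] {a b : ℤ} :
    (a : Fin n) = b ↔ (n : ℤ) ∣ a - b := by
  rw [← sub_eq_zero, ← Int.cast_sub]
  exact CharP.intCast_eq_zero_iff (Fin n) n _

theorem Fin.exists_intCast_eq {n : ℕ} [NeZero n] (v : Fin n) :
    ∃ a : ℤ, 0 ≤ a ∧ a < n ∧ (a : Fin n) = v :=
  ⟨v.val, by omega, by omega, by simp⟩

theorem SimpleGraph.cycleGraph_adj_iff_eq_add_or_sub {n : ℕ} [NeZero n] (hn : 2 ≤ n)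
    {u v : Fin n} : (SimpleGraph.cycleGraph n).Adj u v ↔ v = u + 1 ∨ v = u - 1 := by
  obtain ⟨k, rfl⟩ := Nat.exists_eq_add_of_le' hn
  rw [SimpleGraph.cycleGraph_adj, or_comm, sub_eq_iff_eq_add', sub_eq_iff_eq_add,
    eq_sub_iff_add_eq, add_comm v, eq_comm (a := u)]

variable {m n : ℕ} [NeZero m] [NeZero n]

theorem canMove_torus_iff (hm : 2 ≤ m) (hn : 2 ≤ n) {u v : Fin m × Fin n} :
    CanMove (torus m n) u v ↔ ∃ a b : ℤ, UnitStep a b ∧ v = (u.1 + a, u.2 + b) := by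
  obtain ⟨u1, u2⟩ := u
  obtain ⟨v1, v2⟩ := v
  simp only [CanMove, torus, SimpleGraph.boxProd_adj,
    SimpleGraph.cycleGraph_adj_iff_eq_add_or_sub hm, SimpleGraph.cycleGraph_adj_iff_eq_add_or_sub hn,
    Prod.mk.injEq]
  constructor
  · rintro (⟨rfl, rfl⟩ | ⟨rfl | rfl, rfl⟩ | ⟨rfl | rfl, rfl⟩)
    · exact ⟨0, 0, by unfold UnitStep; omega, by simp⟩
    · exact ⟨1, 0, by unfold UnitStep; omega, by simp⟩
    · exact ⟨-1, 0, by unfold UnitStep; omega, by simp [sub_eq_add_neg]⟩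
    · exact ⟨0, 1, by unfold UnitStep; omega, by simp⟩
    · exact ⟨0, -1, by unfold UnitStep; omega, by simp [sub_eq_add_neg]⟩
  · rintro ⟨a, b, ⟨rfl, rfl⟩ | ⟨rfl, rfl⟩ | ⟨rfl, rfl⟩ | ⟨rfl, rfl⟩ | ⟨rfl, rfl⟩, rfl, rfl⟩ <;>
      simp [sub_eq_add_neg]

/-- Moving along with another agent, so that the relative position stays the same. -/
theorem CanMove.translate (hm : 2 ≤ m) (hn : 2 ≤ n) {u v : Fin m × Fin n}
    (h : CanMove (torus m n) u v) (w : Fin m × Fin n) :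
    CanMove (torus m n) w (w + (v - u)) := by
  rw [canMove_torus_iff hm hn] at h ⊢
  obtain ⟨a, b, hab, rfl⟩ := h
  exact ⟨a, b, hab, by ext1 <;> simp⟩

/-- With the robber at `r` about to move and the cops at `c`, the cops can win within `t` further
rounds while the cop `g` keeps to the column of the robber. -/
def GuardedWin (g : Fin 3) : ℕ → (Fin 3 → Fin m × Fin n) → Fin m × Fin n → Prop
  | 0, c, r => ∃ a, c a = r
  | t + 1, c, r => (∃ a, c a = r) ∨ ∀ r', CanMove (torus m n) r r' → (∃ a, c a = r') ∨
      ∃ c' : Fin 3 → Fin m × Fin n, (∀ a, CanMove (torus m n) (c a) (c' a)) ∧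
        (c' g).2 = r'.2 ∧ GuardedWin g t c' r'

omit [NeZero m] [NeZero n] in
theorem GuardedWin.of_caught {g : Fin 3} {t : ℕ} {c : Fin 3 → Fin m × Fin n} {r : Fin m × Fin n}
    (h : ∃ a, c a = r) : GuardedWin g t c r := by
  cases t with
  | zero => exact h
  | succ t => exact Or.inl h

/-- A win in relative integer coordinates is a win on the torus. -/
theorem Win.guardedWin (hm : 2 ≤ m) (hn : 2 ≤ n) {t : ℕ} {x xA yA xB yB : ℤ}
    (h : Win m n t x xA yA xB yB) {g a b : Fin 3} (hga : g ≠ a) (hgb : g ≠ b) (hab : a ≠ b)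
    {c : Fin 3 → Fin m × Fin n} {r : Fin m × Fin n} (hg : c g = (r.1 + x, r.2))
    (ha : c a = (r.1 + xA, r.2 + yA)) (hb : c b = (r.1 + xB, r.2 + yB)) :
    GuardedWin g t c r := by
  have caught : ((m : ℤ) ∣ x ∨ ((m : ℤ) ∣ xA ∧ (n : ℤ) ∣ yA) ∨ ((m : ℤ) ∣ xB ∧ (n : ℤ) ∣ yB)) →
      ∃ i, c i = r := by
    rw [← CharP.intCast_eq_zero_iff (Fin m) m, ← CharP.intCast_eq_zero_iff (Fin m) m,
      ← CharP.intCast_eq_zero_iff (Fin m) m, ← CharP.intCast_eq_zero_iff (Fin n) n,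
      ← CharP.intCast_eq_zero_iff (Fin n) n]
    rintro (h | ⟨h, h'⟩ | ⟨h, h'⟩)
    · exact ⟨g, by simp [hg, h]⟩
    · exact ⟨a, by simp [ha, h, h']⟩
    · exact ⟨b, by simp [hb, h, h']⟩
  induction t generalizing x xA yA xB yB c r with
  | zero => exact caught h
  | succ t ih =>
    rcases h with h | h
    · exact Or.inl (caught h)
    refine Or.inr fun r' hr' => Or.inr ?_
    obtain ⟨dx, dy, hd, rfl⟩ := (canMove_torus_iff hm hn).1 hr'
    obtain ⟨x', xA', yA', xB', yB', k1, k2, k3, k4⟩ := h dx dy hd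
    have cover : ∀ i, i = g ∨ i = a ∨ i = b := by omega
    let c' : Fin 3 → Fin m × Fin n := fun i =>
      if i = g then (r.1 + dx + x', r.2 + dy)
      else if i = a then (r.1 + dx + xA', r.2 + dy + yA') else (r.1 + dx + xB', r.2 + dy + yB')
    have hg' : c' g = (r.1 + dx + x', r.2 + dy) := if_pos rfl
    have ha' : c' a = (r.1 + dx + xA', r.2 + dy + yA') := by
      simp only [c', if_neg hga.symm, if_pos]
    have hb' : c' b = (r.1 + dx + xB', r.2 + dy + yB') := by
      simp only [c', if_neg hgb.symm, if_neg hab.symm]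
    refine ⟨c', fun i => ?_, by rw [hg'], ih k4 hg' ha' hb' ?_⟩
    · rw [canMove_torus_iff hm hn]
      rcases cover i with rfl | rfl | rfl
      · exact ⟨_, _, k1, by rw [hg, hg']; ext1 <;> push_cast <;> ring⟩
      · exact ⟨_, _, k2, by rw [ha, ha']; ext1 <;> push_cast <;> ring⟩
      · exact ⟨_, _, k3, by rw [hb, hb']; ext1 <;> push_cast <;> ring⟩
    · rw [← CharP.intCast_eq_zero_iff (Fin m) m, ← CharP.intCast_eq_zero_iff (Fin m) m,
        ← CharP.intCast_eq_zero_iff (Fin m) m, ← CharP.intCast_eq_zero_iff (Fin n) n,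
        ← CharP.intCast_eq_zero_iff (Fin n) n]
      rintro (h | ⟨h, h'⟩ | ⟨h, h'⟩)
      · exact ⟨g, by simp [hg', h]⟩
      · exact ⟨a, by simp [ha', h, h']⟩
      · exact ⟨b, by simp [hb', h, h']⟩

/-- Cops in the first row, the guard in the column of the robber and the others not too close to
each other, win within `t` further rounds. -/
theorem guardedWin_of_same_row (hm : 6 ≤ m) (hn : 6 ≤ n) {t d : ℕ} (hd : 1 ≤ d)
    (hrow : n - d + 2 * m ≤ 2 * t + 3 ∨ 5 * (n - d) + 2 * (m / 2) + 4 * m ≤ 8 * t + 10)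
    (hcol : m / 2 + m + (n - d) ≤ 2 * t + 2)
    {g a b : Fin 3} (hga : g ≠ a) (hgb : g ≠ b) (hab : a ≠ b)
    {c : Fin 3 → Fin m × Fin n} {r : Fin m × Fin n} (h0 : ∀ i, (c i).1 = 0) (hg : (c g).2 = r.2)
    {e w : ℤ} (ha : (c a).2 = r.2 + e) (hb : (c b).2 = r.2 + e + w) (hw : d ≤ w)
    (hwn : w ≤ n - d) : GuardedWin g t c r := by
  have hcast : ((m : ℤ) : Fin m) = 0 := by simp
  have hcastn : ((n : ℤ) : Fin n) = 0 := by simp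
  -- the two chasers on the two sides of the robber
  have key : ∃ e' f' : ℤ, ∃ a b : Fin 3, g ≠ a ∧ g ≠ b ∧ a ≠ b ∧ 0 ≤ e' ∧ 0 ≤ f' ∧ d ≤ e' + f' ∧
      e' + f' ≤ n - d ∧ (c a).2 = r.2 + e' ∧ (c b).2 = r.2 + (-f' : ℤ) := by
    -- The columns of the chasers cut the cycle into arcs of lengths `w` and `n - w`; `e' + f'` is
    -- the length of the one containing the robber.
    have h1 := Int.emod_nonneg e (b := n) (by omega)
    have h2 := Int.emod_lt_of_pos e (b := n) (by omega)
    have h3 : ((e % n : ℤ) : Fin n) = e :=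
      Fin.intCast_eq_intCast_iff_dvd.2 ⟨-(e / n), by have := Int.emod_add_mul_ediv e n; linarith⟩
    by_cases hlt : e % n + w < n
    · refine ⟨e % n, n - (e % n + w), a, b, hga, hgb, hab, h1, by omega, by omega, by omega,
        by rw [ha, h3], ?_⟩
      rw [hb, ← h3]; push_cast; simp; ring
    · refine ⟨e % n + w - n, n - e % n, b, a, hgb, hga, hab.symm, by omega, by omega, by omega,
        by omega, ?_, ?_⟩
      · rw [hb, ← h3]; push_cast; simp; ring
      · rw [ha, ← h3]; push_cast; simp
  clear hab hga hgb ha hb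
  obtain ⟨e', f', a, b, hga, hgb, hab, he, hf, hs, hsn, ha, hb⟩ := key
  obtain ⟨y, hy0, hym, hy⟩ := Fin.exists_intCast_eq r.1
  -- The chasers take the shorter way around to the robber, of length `x`, and the guard the longer
  -- one, of length `m - x`.
  have win : ∀ x : ℤ, 0 ≤ x → x ≤ m / 2 → Win m n t (-(m - x)) x e' x (-f') := by
    intro x hx0 hx
    by_cases hx' : e' ≤ x ∨ f' ≤ x
    · exact Win.of_column_near (by omega) he hf (by omega) (by omega) hx' (by omega) (by omega)
    · exact Win.of_row_near (by omega) hx0 (by omega) (by omega) (by omega) (by omega) (by omega)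
  by_cases hy2 : y ≤ m / 2
  · refine Win.guardedWin (by omega) (by omega) (win y hy0 hy2).reflect_row hga hgb hab ?_ ?_ ?_
    · ext1
      · rw [h0, ← hy]; push_cast; simp
      · exact hg
    · ext1
      · rw [h0, ← hy]; push_cast; simp
      · exact ha
    · ext1
      · rw [h0, ← hy]; push_cast; simp
      · exact hb
  · refine Win.guardedWin (by omega) (by omega) (win (m - y) (by omega) (by omega))
      hga hgb hab ?_ ?_ ?_
    · ext1
      · rw [h0, ← hy]; push_cast; simp
      · exact hg
    · ext1
      · rw [h0, ← hy]; push_cast; simp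
      · exact ha
    · ext1
      · rw [h0, ← hy]; push_cast; simp
      · exact hb

end Torus

/-! ### Strategies with memory, given by a rule -/

section Memory

variable {V : Type*} {G : SimpleGraph V} {k : ℕ} {M : Type*}

open Classical in
/-- Move to a configuration allowed by the rule `S`, if there is a legal one; otherwise stay. -/
noncomputable def respond (G : SimpleGraph V)
    (S : ℕ → (Fin k → V) × M → V → V → (Fin k → V) × M → Prop)
    (i : ℕ) (c : (Fin k → V) × M) (p v : V) : (Fin k → V) × M :=
  if h : ∃ c', (∀ a, CanMove G (c.1 a) (c'.1 a)) ∧ S i c p v c' then h.choose else c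

/-- Positions and memory of cops that start from `c₀` and answer according to the rule `S`, which
in round `i + 1` knows the last two positions of the robber. -/
noncomputable def runRule (G : SimpleGraph V)
    (S : ℕ → (Fin k → V) × M → V → V → (Fin k → V) × M → Prop) (c₀ : (Fin k → V) × M)
    (r : ℕ → V) : ℕ → (Fin k → V) × M
  | 0 => c₀
  -- For `i = 0` the truncated `i - 1` is `0`, so both positions are `r 0`.
  | i + 1 => respond G S i (runRule G S c₀ r i) (r (i - 1)) (r i)

variable {S : ℕ → (Fin k → V) × M → V → V → (Fin k → V) × M → Prop} {c₀ : (Fin k → V) × M}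

theorem runRule_congr {r r' : ℕ → V} {i : ℕ} (h : ∀ j < i, r j = r' j) :
    runRule G S c₀ r i = runRule G S c₀ r' i := by
  induction i with
  | zero => rfl
  | succ i ih =>
    rw [runRule, runRule, ih fun j hj => h j (by omega), h i (by omega), h (i - 1) (by omega)]

theorem runRule_succ_spec {r : ℕ → V} {i : ℕ}
    (h : ∃ c', (∀ a, CanMove G ((runRule G S c₀ r i).1 a) (c'.1 a)) ∧
      S i (runRule G S c₀ r i) (r (i - 1)) (r i) c') :
    (∀ a, CanMove G ((runRule G S c₀ r i).1 a) ((runRule G S c₀ r (i + 1)).1 a)) ∧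
      S i (runRule G S c₀ r i) (r (i - 1)) (r i) (runRule G S c₀ r (i + 1)) := by
  rw [runRule, respond, dif_pos h]
  exact h.choose_spec

/-- The strategy of cops with memory that follow the rule `S`. -/
noncomputable def CopStrategy.ofRule (G : SimpleGraph V)
    (S : ℕ → (Fin k → V) × M → V → V → (Fin k → V) × M → Prop) (c₀ : (Fin k → V) × M) :
    CopStrategy G k where
  pos r i := (runRule G S c₀ r i).1
  causal _ _ _ h := by rw [runRule_congr h]
  legal r i a := by
    rw [runRule, respond]
    split_ifs with h
    · exact h.choose_spec.1 a
    · exact Or.inl rfl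

/-- A robber not captured up to its turn of round `i` may continue with `v` forever. -/
theorem CopStrategy.exists_play_of_step (σ : CopStrategy G k) {r : ℕ → V}
    (hr : IsRobberPlay G r) {i : ℕ} (hi : 1 ≤ i) (hcap : ¬ σ.CapturedWithin r (i - 1))
    (hpos : ∀ a, σ.pos r i a ≠ r (i - 1)) {v : V} (hv : CanMove G (r (i - 1)) v)
    (hv' : ∀ a, σ.pos r i a ≠ v) :
    ∃ r' : ℕ → V, IsRobberPlay G r' ∧ (∀ j < i, r j = r' j) ∧ r' i = v ∧
      ¬ σ.CapturedWithin r' i := by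
  have agree : ∀ j < i, r j = if j < i then r j else v := fun j hj => (if_pos hj).symm
  refine ⟨fun j => if j < i then r j else v, fun j => ?_, agree, if_neg (lt_irrefl i), ?_⟩
  · rcases lt_trichotomy (j + 1) i with h | h | h
    · simpa only [if_pos h, if_pos (show j < i by omega)] using hr j
    · obtain rfl : j = i - 1 := by omega
      simpa only [if_neg (show ¬ i - 1 + 1 < i by omega), if_pos (show i - 1 < i by omega)] using hv
    · simp only [if_neg (show ¬ j + 1 < i by omega), if_neg (show ¬ j < i by omega)]
      exact Or.inl rfl
  · rintro ⟨l, hl, a, h⟩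
    rw [← σ.causal r _ l fun j hj => agree j (by omega)] at h
    rcases hl.lt_or_eq with hl | rfl
    · refine hcap ⟨l, by omega, a, ?_⟩
      rcases h with ⟨j, hj, h⟩ | h
      · exact Or.inl ⟨j, hj, by simpa only [if_pos (show j < i by omega)] using h⟩
      · exact Or.inr (by simpa only [if_pos hl] using h)
    · rcases h with ⟨j, rfl, h⟩ | h
      · exact hpos a (by simpa using h)
      · exact hv' a (by simpa using h)

end Memory

/-! ### Getting a guard into the column of the robber -/

section Approach

open Fin.CommRing

variable {m n : ℕ} [NeZero m] [NeZero n]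

/-- Translations are automorphisms of the torus, so cops that copy the robber's move lose nothing
but the round. -/
theorem GuardedWin.translate {g : Fin 3} {t : ℕ} {c : Fin 3 → Fin m × Fin n} {r : Fin m × Fin n}
    (h : GuardedWin g t c r) (hm : 2 ≤ m) (hn : 2 ≤ n) (d : Fin m × Fin n) :
    GuardedWin g t (fun a => c a + d) (r + d) := by
  have move : ∀ {u v : Fin m × Fin n} (e : Fin m × Fin n), CanMove (torus m n) u v →
      CanMove (torus m n) (u + e) (v + e) := by
    intro u v e h
    have := h.translate hm hn (u + e)
    rwa [show u + e + (v - u) = v + e by ring] at this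
  induction t generalizing c r with
  | zero =>
    obtain ⟨a, ha⟩ := h
    exact ⟨a, congrArg (· + d) ha⟩
  | succ t ih =>
    rcases h with ⟨a, ha⟩ | h
    · exact Or.inl ⟨a, congrArg (· + d) ha⟩
    refine Or.inr fun r' hr' => ?_
    rcases h (r' - d) (by simpa [sub_eq_add_neg] using move (-d) hr') with ⟨a, ha⟩ | ⟨c', h1, h2, h3⟩
    · exact Or.inl ⟨a, eq_sub_iff_add_eq.1 ha⟩
    · refine Or.inr ⟨fun a => c' a + d, fun a => move d (h1 a), ?_, ?_⟩
      · simp [h2]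
      · simpa using ih h3

/-- The cops are in the first row, and within `k` further rounds the cop in memory will be in the
column of the robber: either it is there already, and the two others are at distance at least `d`
from each other, or two cops close in on the column of the robber from both sides. -/
def Approaching (d k : ℕ) (c : (Fin 3 → Fin m × Fin n) × Fin 3) (y : Fin n) : Prop :=
  (∀ a, (c.1 a).1 = 0) ∧
  ((∃ a b : Fin 3, c.2 ≠ a ∧ c.2 ≠ b ∧ a ≠ b ∧ ∃ e w : ℤ, (d : ℤ) ≤ w ∧ w ≤ n - d ∧
      (c.1 c.2).2 = y ∧ (c.1 a).2 = y + e ∧ (c.1 b).2 = y + e + w) ∨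
    ∃ i a b : Fin 3, i ≠ a ∧ i ≠ b ∧ a ≠ b ∧ ∃ p q u w : ℤ, 1 ≤ p ∧ 1 ≤ q ∧ p + q ≤ 2 * k + 1 ∧
      (d : ℤ) ≤ u ∧ (d : ℤ) ≤ w ∧ p + q + u + w = n ∧
      (c.1 i).2 = y - p ∧ (c.1 a).2 = y + q ∧ (c.1 b).2 = y + q + u)

/-- The two enclosing cops step inwards, which shortens `p + q` by 2 and only widens the gaps `u`,
`w` to the third cop. If one of them is in the column already, all cops stay; one that arrives
becomes the guard. -/
theorem exists_approaching_of_between (hm : 2 ≤ m) (hn : 2 ≤ n) {d k : ℕ}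
    {c : (Fin 3 → Fin m × Fin n) × Fin 3} {y : Fin n} (h0 : ∀ a, (c.1 a).1 = 0)
    {i a b : Fin 3} (hia : i ≠ a) (hib : i ≠ b) (hab : a ≠ b) {p q u w : ℤ} (hp : 0 ≤ p)
    (hq : 0 ≤ q) (hpq : p + q ≤ 2 * k + 3) (hu : d ≤ u) (hw : d ≤ w) (hsum : p + q + u + w = n)
    (hi : (c.1 i).2 = y - p) (ha : (c.1 a).2 = y + q) (hb : (c.1 b).2 = y + q + u) :
    ∃ c' : (Fin 3 → Fin m × Fin n) × Fin 3,
      (∀ a, CanMove (torus m n) (c.1 a) (c'.1 a)) ∧ Approaching d k c' y := by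
  have hcastn : ((p + q + u + w : ℤ) : Fin n) = 0 := by rw [hsum]; simp
  have hbw : (c.1 b).2 = y - p - w := by
    rw [hb, ← sub_eq_zero, ← hcastn]; push_cast; ring
  by_cases hp0 : p = 0
  · refine ⟨(c.1, i), fun _ => Or.inl rfl, h0, Or.inl ⟨a, b, hia, hib, hab, q, u, hu, by omega,
      ?_, ha, hb⟩⟩
    simp [hi, hp0]
  by_cases hq0 : q = 0
  · refine ⟨(c.1, a), fun _ => Or.inl rfl, h0, Or.inl ⟨b, i, hab, hia.symm, hib.symm, u, w, hw,
      by omega, ?_, ?_, ?_⟩⟩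
    · simp [ha, hq0]
    · simp [hb, hq0]
    · rw [hi, ← sub_eq_zero, ← neg_eq_zero, ← hcastn, hq0]; push_cast; ring
  let f : Fin 3 → Fin m × Fin n := fun j =>
    if j = i then (0, y - (p - 1 : ℤ)) else if j = a then (0, y + (q - 1 : ℤ)) else c.1 j
  have fi : f i = (0, y - (p - 1 : ℤ)) := if_pos rfl
  have fa : f a = (0, y + (q - 1 : ℤ)) := by simp only [f, if_neg hia.symm, if_pos]
  have fb : f b = c.1 b := by simp only [f, if_neg hib.symm, if_neg hab.symm]
  have cover : ∀ j, j = i ∨ j = a ∨ j = b := by omega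
  have f0 : ∀ j, (f j).1 = 0 := by
    intro j
    rcases cover j with rfl | rfl | rfl
    · rw [fi]
    · rw [fa]
    · rw [fb, h0]
  have fmove : ∀ j, CanMove (torus m n) (c.1 j) (f j) := by
    intro j
    rw [canMove_torus_iff hm hn]
    rcases cover j with rfl | rfl | rfl
    · exact ⟨0, 1, by unfold UnitStep; omega, by rw [fi]; ext1 <;> simp [h0, hi]; ring⟩
    · exact ⟨0, -1, by unfold UnitStep; omega, by rw [fa]; ext1 <;> simp [h0, ha]; ring⟩
    · exact ⟨0, 0, by unfold UnitStep; omega, by ext1 <;> simp [fb]⟩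
  by_cases hp1 : p = 1
  · refine ⟨(f, i), fmove, f0, Or.inl ⟨a, b, hia, hib, hab, q - 1, u + 1, by omega, by omega,
      ?_, ?_, ?_⟩⟩
    · simp [fi, hp1]
    · simp [fa]
    · simp only [fb, hb]; push_cast; ring
  by_cases hq1 : q = 1
  · refine ⟨(f, a), fmove, f0, Or.inl ⟨b, i, hab, hia.symm, hib.symm, u + 1, w + 1, by omega,
      by omega, ?_, ?_, ?_⟩⟩
    · simp [fa, hq1]
    · simp only [fb, hb, hq1]; push_cast; ring
    · simp only [fi]
      rw [← sub_eq_zero, ← neg_eq_zero, ← hcastn, hq1]; push_cast; ring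
  · refine ⟨(f, i), fmove, f0, Or.inr ⟨i, a, b, hia, hib, hab, p - 1, q - 1, u + 1, w + 1,
      by omega, by omega, by omega, by omega, by omega, by omega, ?_, ?_, ?_⟩⟩
    · simp only [fi]
    · simp only [fa]
    · simp only [fb, hb]; push_cast; ring

/-- A sidestep of the robber only shifts distance between the two enclosing cops; their sum is
unchanged. A guard already in place copies the sidestep while the others stay. -/
theorem Approaching.exists_step (hm : 2 ≤ m) (hn : 2 ≤ n) {d k : ℕ}
    {c : (Fin 3 → Fin m × Fin n) × Fin 3} {p v : Fin m × Fin n}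
    (h : Approaching d (k + 1) c p.2) (hv : CanMove (torus m n) p v) :
    ∃ c' : (Fin 3 → Fin m × Fin n) × Fin 3,
      (∀ a, CanMove (torus m n) (c.1 a) (c'.1 a)) ∧ Approaching d k c' v.2 := by
  obtain ⟨dx, dy, hd, rfl⟩ := (canMove_torus_iff hm hn).1 hv
  have hdy : -1 ≤ dy ∧ dy ≤ 1 := by unfold UnitStep at hd; omega
  obtain ⟨h0, ⟨a, b, hga, hgb, hab, e, w, hw, hwn, hg, ha, hb⟩ |
    ⟨i, a, b, hia, hib, hab, q, q', u, w, h1, h2, h3, h4, h5, h6, hi, ha, hb⟩⟩ := h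
  · have upd : ∀ j, j ≠ c.2 → Function.update c.1 c.2 (0, p.2 + dy) j = c.1 j :=
      fun j hj => Function.update_of_ne hj _ _
    refine ⟨(Function.update c.1 c.2 (0, p.2 + dy), c.2), fun j => ?_, fun j => ?_,
      Or.inl ⟨a, b, hga, hgb, hab, e - dy, w, hw, hwn, by simp, ?_, ?_⟩⟩
    · by_cases hj : j = c.2
      · subst hj
        rw [canMove_torus_iff hm hn]
        exact ⟨0, dy, by unfold UnitStep; omega, by ext1 <;> simp [h0, hg]⟩
      · exact Or.inl (upd j hj).symm
    · by_cases hj : j = c.2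
      · subst hj; simp
      · simp only [upd j hj, h0]
    · simp only [upd a hga.symm, ha]; push_cast; ring
    · simp only [upd b hgb.symm, hb]; push_cast; ring
  · refine exists_approaching_of_between hm hn h0 hia hib hab (p := q + dy) (q := q' - dy)
      (u := u) (w := w) (by omega) (by omega) (by push_cast at h3; omega) h4 h5 (by omega) ?_ ?_ ?_
    · rw [hi]; push_cast; ring
    · rw [ha]; push_cast; ring
    · rw [hb]; push_cast; ring

/-- The cops start in the first row, as evenly spaced as possible. -/
def evenStart (m n : ℕ) [NeZero m] [NeZero n] : (Fin 3 → Fin m × Fin n) × Fin 3 :=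
  (![(0, 0), (0, ((n / 3 : ℕ) : ℤ)), (0, ((n / 3 + (n + 1) / 3 : ℕ) : ℤ))], 0)

theorem evenStart_row (a : Fin 3) : ((evenStart m n).1 a).1 = 0 := by
  fin_cases a <;> rfl

theorem exists_approaching_of_evenStart (hm : 2 ≤ m) (hn : 2 ≤ n) {k : ℕ}
    (hk : (n + 2) / 3 ≤ 2 * k + 3) (y : Fin n) :
    ∃ c' : (Fin 3 → Fin m × Fin n) × Fin 3,
      (∀ a, CanMove (torus m n) ((evenStart m n).1 a) (c'.1 a)) ∧
        Approaching (n / 3) k c' y := by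
  obtain ⟨z, hz0, hzn, rfl⟩ := Fin.exists_intCast_eq y
  have hcastn : ((n : ℤ) : Fin n) = 0 := by simp
  have e0 : ((evenStart m n).1 0).2 = 0 := rfl
  have e1 : ((evenStart m n).1 1).2 = ((n / 3 : ℕ) : ℤ) := rfl
  have e2 : ((evenStart m n).1 2).2 = ((n / 3 + (n + 1) / 3 : ℕ) : ℤ) := rfl
  by_cases h1 : z ≤ (n / 3 : ℕ)
  · refine exists_approaching_of_between hm hn evenStart_row (i := 0) (a := 1) (b := 2)
      (by decide) (by decide) (by decide) (p := z) (q := (n / 3 : ℕ) - z)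
      (u := ((n + 1) / 3 : ℕ)) (w := ((n + 2) / 3 : ℕ)) hz0 (by omega) (by omega) (by omega)
      (by omega) (by omega) ?_ ?_ ?_
    · rw [e0]; ring
    · rw [e1]; push_cast; ring
    · rw [e2]; push_cast; ring
  by_cases h2 : z ≤ (n / 3 + (n + 1) / 3 : ℕ)
  · refine exists_approaching_of_between hm hn evenStart_row (i := 1) (a := 2) (b := 0)
      (by decide) (by decide) (by decide) (p := z - (n / 3 : ℕ))
      (q := (n / 3 + (n + 1) / 3 : ℕ) - z) (u := ((n + 2) / 3 : ℕ)) (w := (n / 3 : ℕ))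
      (by omega) (by omega) (by omega) (by omega) (by omega) (by omega) ?_ ?_ ?_
    · rw [e1]; push_cast; ring
    · rw [e2]; push_cast; ring
    · rw [e0, ← hcastn, show (n : ℤ) = (n / 3 + (n + 1) / 3 : ℕ) + ((n + 2) / 3 : ℕ) by omega]
      push_cast; ring
  · refine exists_approaching_of_between hm hn evenStart_row (i := 2) (a := 0) (b := 1)
      (by decide) (by decide) (by decide) (p := z - (n / 3 + (n + 1) / 3 : ℕ))
      (q := n - z) (u := (n / 3 : ℕ)) (w := ((n + 1) / 3 : ℕ))
      (by omega) (by omega) (by omega) (by omega) (by omega) (by omega) ?_ ?_ ?_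
    · rw [e2]; push_cast; ring
    · rw [e0]; push_cast; simp
    · rw [e1]; push_cast; simp

end Approach

/-! ### The delayed strategy and its exact capture time -/

section GuardPlusChase

open Fin.CommRing

variable {m n : ℕ} [NeZero m] [NeZero n]

/-- The rule for three cops that are to capture the robber in round `t`. In the first `k₀` rounds
a guard gets into the column of the robber. Then the cops keep their positions relative to the
robber as long as the remaining rounds suffice for a guarded win from there, and otherwise
make a move that leads to a guarded win in the remaining rounds. -/
def guardChaseRule (d k₀ t i : ℕ) (c : (Fin 3 → Fin m × Fin n) × Fin 3) (p v : Fin m × Fin n)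
    (c' : (Fin 3 → Fin m × Fin n) × Fin 3) : Prop :=
  if i < k₀ then Approaching d (k₀ - 1 - i) c' v.2
  else c'.2 = c.2 ∧ (c'.1 c.2).2 = v.2 ∧ GuardedWin c.2 (t - i - 1) c'.1 v ∧
    (GuardedWin c.2 (t - i - 1) c.1 p → c'.1 = fun a => c.1 a + (v - p))

variable (m n) in
/-- Positions of the cops and choice of the guard under `guardChaseRule`. -/
noncomputable def guardChaseRun (k₀ t : ℕ) (r : ℕ → Fin m × Fin n) (i : ℕ) :
    (Fin 3 → Fin m × Fin n) × Fin 3 :=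
  runRule (torus m n) (guardChaseRule (n / 3) k₀ t) (evenStart m n) r i

variable (m n) in
/-- The strategy given by `guardChaseRule`. -/
noncomputable def guardChase (k₀ t : ℕ) : CopStrategy (torus m n) 3 :=
  CopStrategy.ofRule (torus m n) (guardChaseRule (n / 3) k₀ t) (evenStart m n)

variable {k₀ t : ℕ} {r : ℕ → Fin m × Fin n}

theorem guardChase_pos (r : ℕ → Fin m × Fin n) (i : ℕ) (a : Fin 3) :
    (guardChase m n k₀ t).pos r i a = (guardChaseRun m n k₀ t r i).1 a := rfl

theorem approaching_guardChaseRun (hm : 2 ≤ m) (hn : 2 ≤ n) (hk₀ : (n + 2) / 3 ≤ 2 * k₀ + 1)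
    (hr : IsRobberPlay (torus m n) r) {i : ℕ} (hi : i < k₀) :
    Approaching (n / 3) (k₀ - 1 - i) (guardChaseRun m n k₀ t r (i + 1)) (r i).2 := by
  induction i with
  | zero =>
    obtain ⟨c', h1, h2⟩ := exists_approaching_of_evenStart (k := k₀ - 1 - 0) hm hn (by omega) (r 0).2
    have := (runRule_succ_spec (G := torus m n) (S := guardChaseRule (n / 3) k₀ t)
      (c₀ := evenStart m n) (r := r) (i := 0)
      ⟨c', h1, by rw [guardChaseRule, if_pos hi]; exact h2⟩).2
    rwa [guardChaseRule, if_pos hi] at this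
  | succ i ih =>
    have ih := ih (by omega)
    rw [show k₀ - 1 - i = k₀ - 1 - (i + 1) + 1 by omega] at ih
    obtain ⟨c', h1, h2⟩ := ih.exists_step hm hn (hr i)
    have := (runRule_succ_spec (G := torus m n) (S := guardChaseRule (n / 3) k₀ t)
      (c₀ := evenStart m n) (r := r) (i := i + 1)
      ⟨c', h1, by rw [guardChaseRule, if_pos hi]; exact h2⟩).2
    rwa [guardChaseRule, if_pos hi] at this

/-- The numbers of rounds are such that the strategy is successful. -/
structure Feasible (m n k₀ t : ℕ) : Prop where
  hm : 6 ≤ m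
  hn : 6 ≤ n
  pos : 1 ≤ k₀
  lt : k₀ < t
  -- `(n + 2) / 3` is the largest initial gap. Below, `n - n / 3` bounds the arc between the chasers
  -- that contains the robber, and `m / 2` its distance from their row.
  guard : (n + 2) / 3 ≤ 2 * k₀ + 1
  row : n - n / 3 + 2 * m ≤ 2 * (t - k₀) + 3 ∨
    5 * (n - n / 3) + 2 * (m / 2) + 4 * m ≤ 8 * (t - k₀) + 10
  column : m / 2 + m + (n - n / 3) ≤ 2 * (t - k₀) + 2

theorem Feasible.guarded_of_eq (H : Feasible m n k₀ t) (hr : IsRobberPlay (torus m n) r) :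
    ((guardChaseRun m n k₀ t r k₀).1 (guardChaseRun m n k₀ t r k₀).2).2 = (r (k₀ - 1)).2 ∧
      GuardedWin (guardChaseRun m n k₀ t r k₀).2 (t - k₀) (guardChaseRun m n k₀ t r k₀).1
        (r (k₀ - 1)) := by
  have hm := H.hm
  have hn := H.hn
  have hpos := H.pos
  have := approaching_guardChaseRun (t := t) (by omega) (by omega) H.guard hr
    (show k₀ - 1 < k₀ by omega)
  rw [Nat.sub_add_cancel H.pos, Nat.sub_self] at this
  obtain ⟨h0, ⟨a, b, hga, hgb, hab, e, w, hw, hwn, hg, ha, hb⟩ |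
    ⟨i, a, b, hia, hib, hab, p, q, u, w, h1, h2, h3, -⟩⟩ := this
  · exact ⟨hg, guardedWin_of_same_row H.hm H.hn (by omega) H.row H.column hga hgb hab h0 hg ha hb hw
      hwn⟩
  -- No rounds of approach are left, so `p + q ≤ 1`, against `1 ≤ p` and `1 ≤ q`.
  · push_cast at h3; omega

omit [NeZero m] [NeZero n] in
theorem not_caughtIn {σ : CopStrategy (torus m n) 3} {i : ℕ} (h : ¬ σ.CapturedWithin r i)
    (hi : 1 ≤ i) (a : Fin 3) : σ.pos r i a ≠ r (i - 1) ∧ σ.pos r i a ≠ r i :=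
  ⟨fun ha => h ⟨i, le_rfl, a, Or.inl ⟨i - 1, by omega, ha⟩⟩,
    fun ha => h ⟨i, le_rfl, a, Or.inr ha⟩⟩

/-- The rule can always be obeyed: if the old relative position still wins with one round less,
translate; otherwise use the answer that the guarded win provides. -/
theorem Feasible.rule_of_guarded (H : Feasible m n k₀ t) (hr : IsRobberPlay (torus m n) r) {i : ℕ}
    (hi : k₀ ≤ i) (hit : i < t) (hcap : ¬ (guardChase m n k₀ t).CapturedWithin r i)
    (hcol : ((guardChaseRun m n k₀ t r i).1 (guardChaseRun m n k₀ t r i).2).2 = (r (i - 1)).2)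
    (hwin : GuardedWin (guardChaseRun m n k₀ t r i).2 (t - i) (guardChaseRun m n k₀ t r i).1
      (r (i - 1))) :
    (∀ a, CanMove (torus m n) ((guardChaseRun m n k₀ t r i).1 a)
      ((guardChaseRun m n k₀ t r (i + 1)).1 a)) ∧
    guardChaseRule (n / 3) k₀ t i (guardChaseRun m n k₀ t r i) (r (i - 1)) (r i)
      (guardChaseRun m n k₀ t r (i + 1)) := by
  have hm := H.hm
  have hn := H.hn
  have hpos := H.pos
  have hmove : CanMove (torus m n) (r (i - 1)) (r i) := by
    have := hr (i - 1)
    rwa [Nat.sub_add_cancel (by omega)] at this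
  refine runRule_succ_spec ?_
  change ∃ c', (∀ a, CanMove (torus m n) ((guardChaseRun m n k₀ t r i).1 a) (c'.1 a)) ∧
    guardChaseRule (n / 3) k₀ t i (guardChaseRun m n k₀ t r i) (r (i - 1)) (r i) c'
  generalize hc : guardChaseRun m n k₀ t r i = c at *
  have hfree : ∀ a, c.1 a ≠ r (i - 1) ∧ c.1 a ≠ r i := fun a => by
    simpa [guardChase_pos, hc] using not_caughtIn hcap (by omega) a
  simp only [guardChaseRule, if_neg (show ¬ i < k₀ by omega)]
  by_cases hcopy : GuardedWin c.2 (t - i - 1) c.1 (r (i - 1))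
  · refine ⟨(fun a => c.1 a + (r i - r (i - 1)), c.2), fun a => hmove.translate (by omega)
      (by omega) _, rfl, by simp [hcol], ?_, fun _ => rfl⟩
    simpa using hcopy.translate (by omega) (by omega) (r i - r (i - 1))
  · rw [show t - i = t - i - 1 + 1 by omega] at hwin
    rcases hwin with ⟨a, ha⟩ | hwin
    · exact absurd ha (hfree a).1
    rcases hwin (r i) hmove with ⟨a, ha⟩ | ⟨c', h1, h2, h3⟩
    · exact absurd ha (hfree a).2
    · exact ⟨(c', c.2), h1, rfl, h2, h3, fun h => absurd h hcopy⟩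

theorem CopStrategy.CapturedWithin.mono {V : Type*} {G : SimpleGraph V} {k : ℕ}
    {σ : CopStrategy G k} {r : ℕ → V} {s s' : ℕ} (h : σ.CapturedWithin r s) (hs : s ≤ s') :
    σ.CapturedWithin r s' := by
  obtain ⟨i, hi, h⟩ := h
  exact ⟨i, hi.trans hs, h⟩

theorem Feasible.guarded (H : Feasible m n k₀ t) (hr : IsRobberPlay (torus m n) r) {i : ℕ}
    (hi : k₀ ≤ i) (hit : i ≤ t) (hcap : ¬ (guardChase m n k₀ t).CapturedWithin r (i - 1)) :
    (guardChaseRun m n k₀ t r i).2 = (guardChaseRun m n k₀ t r k₀).2 ∧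
    ((guardChaseRun m n k₀ t r i).1 (guardChaseRun m n k₀ t r i).2).2 = (r (i - 1)).2 ∧
    GuardedWin (guardChaseRun m n k₀ t r i).2 (t - i) (guardChaseRun m n k₀ t r i).1
      (r (i - 1)) := by
  induction i, hi using Nat.le_induction with
  | base => exact ⟨rfl, H.guarded_of_eq hr⟩
  | succ i hi ih =>
    obtain ⟨h1, h2, h3⟩ := ih (by omega) fun h => hcap (h.mono (by omega))
    have := (H.rule_of_guarded hr hi (by omega) hcap h2 h3).2
    rw [guardChaseRule, if_neg (by omega)] at this
    obtain ⟨k1, k2, k3, -⟩ := this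
    rw [Nat.sub_sub] at k3
    rw [k1]
    exact ⟨h1, k2, k3⟩

theorem Feasible.capturedWithin (H : Feasible m n k₀ t) (hr : IsRobberPlay (torus m n) r) :
    (guardChase m n k₀ t).CapturedWithin r t := by
  have hlt := H.lt
  by_contra hcap
  obtain ⟨-, -, h⟩ := H.guarded hr hlt.le le_rfl fun h => hcap (h.mono (by omega))
  rw [Nat.sub_self] at h
  obtain ⟨a, ha⟩ := h
  exact (not_caughtIn hcap (by omega) a).1 ha

/-- While the cops can afford to wait, the robber stays and so do they. Once they cannot, the
failure of `GuardedWin` with one round less yields a robber move after which no guarded answer wins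
in time, in particular none captures at once. -/
theorem Feasible.exists_survivor (H : Feasible m n k₀ t) {i : ℕ} (hi : k₀ ≤ i) (hit : i < t) :
    ∃ r, IsRobberPlay (torus m n) r ∧ ¬ (guardChase m n k₀ t).CapturedWithin r (i - 1) ∧
      ∀ a, (guardChase m n k₀ t).pos r i a ≠ r (i - 1) := by
  have hm := H.hm
  have hn := H.hn
  have hpos := H.pos
  induction i, hi using Nat.le_induction with
  | base =>
    -- Up to round `k₀` the cops do not leave row `0`, so a robber resting in row `3` is safe.
    have hr : IsRobberPlay (torus m n) fun _ => ((⟨3, by omega⟩ : Fin m), 0) :=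
      fun _ => Or.inl rfl
    have hrow : ∀ j ≤ k₀, ∀ a, ((guardChase m n k₀ t).pos
        (fun _ => ((⟨3, by omega⟩ : Fin m), 0)) j a).1 = 0 := by
      intro j hj a
      cases j with
      | zero => exact evenStart_row a
      | succ j => exact (approaching_guardChaseRun (by omega) (by omega) H.guard hr hj).1 a
    have hne : ∀ j ≤ k₀, ∀ a, (guardChase m n k₀ t).pos
        (fun _ => ((⟨3, by omega⟩ : Fin m), 0)) j a ≠ ((⟨3, by omega⟩ : Fin m), 0) := by
      intro j hj a h
      have := hrow j hj a
      rw [h, Fin.ext_iff] at this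
      simp at this
    refine ⟨_, hr, ?_, hne k₀ le_rfl⟩
    rintro ⟨j, hj, a, ⟨l, rfl, h⟩ | h⟩
    · exact hne (l + 1) (by omega) a h
    · exact hne j (by omega) a h
  | succ i hi ih =>
    obtain ⟨r, hr, hcap, hfree⟩ := ih (by omega)
    obtain ⟨-, hcol, -⟩ := H.guarded hr hi (by omega) hcap
    have hmv : ∃ v, CanMove (torus m n) (r (i - 1)) v ∧
        (∀ a, (guardChaseRun m n k₀ t r i).1 a ≠ v) ∧
        ((GuardedWin (guardChaseRun m n k₀ t r i).2 (t - i - 1) (guardChaseRun m n k₀ t r i).1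
            (r (i - 1)) ∧ v = r (i - 1)) ∨
          ∀ c' : Fin 3 → Fin m × Fin n, (∀ a, CanMove (torus m n) ((guardChaseRun m n k₀ t r i).1 a) (c' a)) →
            (c' (guardChaseRun m n k₀ t r i).2).2 = v.2 → ∀ a, c' a ≠ v) := by
      by_cases hcopy : GuardedWin (guardChaseRun m n k₀ t r i).2 (t - i - 1)
          (guardChaseRun m n k₀ t r i).1 (r (i - 1))
      · exact ⟨_, Or.inl rfl, hfree, Or.inl ⟨hcopy, rfl⟩⟩
      · rw [show t - i - 1 = t - i - 2 + 1 by omega] at hcopy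
        simp only [GuardedWin] at hcopy
        push Not at hcopy
        obtain ⟨-, v, hv, hva, hc'⟩ := hcopy
        exact ⟨v, hv, hva, Or.inr fun c' h1 h2 a ha => hc' c' h1 h2 (.of_caught ⟨a, ha⟩)⟩
    obtain ⟨v, hv, hva, hsafe⟩ := hmv
    obtain ⟨r', hr', hagree, rfl, hcap'⟩ := CopStrategy.exists_play_of_step _ hr (by omega) hcap
      hfree hv hva
    have hrun : guardChaseRun m n k₀ t r i = guardChaseRun m n k₀ t r' i := runRule_congr hagree
    rw [hrun, hagree (i - 1) (by omega)] at hsafe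
    obtain ⟨-, hcol', hwin'⟩ := H.guarded hr' hi (by omega) fun h => hcap' (h.mono (by omega))
    obtain ⟨hlegal, hrule⟩ := H.rule_of_guarded hr' hi (by omega) hcap' hcol' hwin'
    rw [guardChaseRule, if_neg (by omega)] at hrule
    obtain ⟨-, h2, -, h4⟩ := hrule
    refine ⟨r', hr', hcap', fun a => ?_⟩
    rw [Nat.add_sub_cancel]
    rcases hsafe with ⟨hcopy, hstay⟩ | hsafe
    · rw [guardChase_pos, h4 hcopy, hstay, sub_self]
      rw [← hagree (i - 1) (by omega), ← hrun]
      simpa [guardChase_pos] using hfree a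
    · exact hsafe _ hlegal h2 a

theorem Feasible.hasCaptureTime (H : Feasible m n k₀ t) :
    (guardChase m n k₀ t).HasCaptureTime t := by
  have hpos := H.pos
  have hlt := H.lt
  refine ⟨fun r hr => H.capturedWithin hr, fun s hs => ?_⟩
  by_contra hst
  obtain ⟨r, hr, hcap, hfree⟩ := H.exists_survivor (i := t - 1) (by omega) (by omega)
  obtain ⟨r', hr', -, -, hcap'⟩ := CopStrategy.exists_play_of_step _ hr (by omega) hcap hfree
    (Or.inl rfl) hfree
  exact hcap' ((hs r' hr').mono (by omega))

theorem Feasible.isGuardPlusChase (H : Feasible m n k₀ t)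
    (hk₀ : k₀ = (2 * n) ⌈/⌉ 3 - n ⌈/⌉ 2) : (guardChase m n k₀ t).IsGuardPlusChase := by
  intro r hr
  refine ⟨(guardChaseRun m n k₀ t r k₀).2, fun i hi hcap => ?_⟩
  rw [← hk₀] at hi
  have hit : i + 1 ≤ t := by
    by_contra h
    exact hcap ((H.capturedWithin hr).mono (by omega))
  obtain ⟨h1, h2, -⟩ := H.guarded hr hi hit fun h => hcap (h.mono (by omega))
  rw [guardChase_pos, ← h1]
  exact h2

end GuardPlusChase

/-! ### Choice of the capture time -/

/-- A guard-plus-chase strategy whose capture time is a given number that is not too small. -/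
theorem exists_guardPlusChase_hasCaptureTime {m n k₀ t : ℕ} (H : Feasible m n k₀ t)
    (hk₀ : k₀ = (2 * n) ⌈/⌉ 3 - n ⌈/⌉ 2) :
    ∃ σ : CopStrategy (torus m n) 3, σ.IsGuardPlusChase ∧ σ.HasCaptureTime t := by
  have hm := H.hm
  have hn := H.hn
  have : NeZero m := ⟨by omega⟩
  have : NeZero n := ⟨by omega⟩
  exact ⟨guardChase m n k₀ t, H.isGuardPlusChase hk₀, H.hasCaptureTime⟩

theorem mainTheorem3 (m n : ℕ) (hm : 6 ≤ m) (hmn : m ≤ n) :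
    ∃ (σ : CopStrategy (torus m n) 3) (t : ℕ),
      σ.IsGuardPlusChase ∧ σ.HasCaptureTime t ∧
      (m ≤ n ⌈/⌉ 2 →
        2 * (n : ℝ) / 3 + 5 * (m : ℝ) / 4 - 9 / 2 ≤ (t : ℝ) ∧
        (t : ℝ) ≤ 2 * (n : ℝ) / 3 + 5 * (m : ℝ) / 4 - 25 / 12) ∧
      (n ⌈/⌉ 2 < m →
        25 * (n : ℝ) / 24 + (m : ℝ) / 2 - 9 / 2 ≤ (t : ℝ) ∧
        (t : ℝ) ≤ 25 * (n : ℝ) / 24 + (m : ℝ) / 2 - 17 / 8) := by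
  have c2 : n ⌈/⌉ 2 = (n + 1) / 2 := Nat.ceilDiv_eq_add_pred_div ..
  have c3 : (2 * n) ⌈/⌉ 3 = (2 * n + 2) / 3 := Nat.ceilDiv_eq_add_pred_div ..
  by_cases hcase : m ≤ n ⌈/⌉ 2
  -- The largest integer below the upper bound in (i); in the other case `t` is chosen likewise from
  -- (ii).
  · obtain ⟨t, ht⟩ : ∃ t, t = (8 * n + 15 * m - 25) / 12 := ⟨_, rfl⟩
    have ht1 : 12 * t + 25 ≤ 8 * n + 15 * m := by omega
    have ht2 : 8 * n + 15 * m < 12 * t + 37 := by omega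
    rw [c2] at hcase
    obtain ⟨σ, h1, h2⟩ := exists_guardPlusChase_hasCaptureTime (m := m) (n := n) (t := t)
      ⟨hm, by omega, by omega, by omega, by omega, Or.inl (by omega), by omega⟩ rfl
    refine ⟨σ, t, h1, h2, fun _ => ?_, fun h => by omega⟩
    have ht1' : 12 * (t : ℝ) + 25 ≤ 8 * n + 15 * m := by exact_mod_cast ht1
    have ht2' : 8 * (n : ℝ) + 15 * m < 12 * t + 37 := by exact_mod_cast ht2
    constructor <;> linarith
  · obtain ⟨t, ht⟩ : ∃ t, t = (25 * n + 12 * m - 51) / 24 := ⟨_, rfl⟩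
    have ht1 : 24 * t + 51 ≤ 25 * n + 12 * m := by omega
    have ht2 : 25 * n + 12 * m < 24 * t + 75 := by omega
    rw [c2] at hcase
    -- The cruder alternative of `Feasible.row` would fail here for `m = n = 6`.
    obtain ⟨hrow, hcol⟩ :
        5 * (n - n / 3) + 2 * (m / 2) + 4 * m ≤ 8 * (t - ((2 * n) ⌈/⌉ 3 - n ⌈/⌉ 2)) + 10 ∧
          m / 2 + m + (n - n / 3) ≤ 2 * (t - ((2 * n) ⌈/⌉ 3 - n ⌈/⌉ 2)) + 2 := by
      rw [c2, c3]
      -- For small `n` the roundings matter, and the finitely many pairs are checked one by one.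
      rcases lt_or_ge n 12 with hn | hn
      · clear ht1 ht2 c2 c3
        have h6 : 6 ≤ n := hm.trans hmn
        interval_cases n <;> interval_cases m <;> omega
      · omega
    obtain ⟨σ, h1, h2⟩ := exists_guardPlusChase_hasCaptureTime (m := m) (n := n) (t := t)
      ⟨hm, by omega, by omega, by omega, by omega, Or.inr hrow, hcol⟩ rfl
    refine ⟨σ, t, h1, h2, fun h => by omega, fun _ => ?_⟩
    have ht1' : 24 * (t : ℝ) + 51 ≤ 25 * n + 12 * m := by exact_mod_cast ht1
    have ht2' : 25 * (n : ℝ) + 12 * m < 24 * t + 75 := by exact_mod_cast ht2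
    constructor <;> linarith
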